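/- Let $\kappa\in\{-1,0,1\}$ and let $\mathbb M(\kappa)$ be the connected, simply connected, complete surface of constant curvature $\kappa$, with metric $g_2$ (that is, $\mathbb H^2$, $\mathbb R^2$ or $\mathbb S^2$). For an open interval $I\subset\mathbb R$ and a smooth function $f:I\to\mathbb R$, let $\mathbb M(\kappa)_f\times I$ be the warped product $\mathbb M(\kappa)\times I$ with the metric $\overline g=e^{2f(t)}g_2+dt^2$ and Levi-Civita connection $\overline\nabla$. A smooth immersion of a smooth surface $\Sigma$ (without boundary) into $\mathbb M(\kappa)_f\times I$, with smooth unit normal field $N$, is totally umbilical if there is $\varrho\in C^\infty(\Sigma)$, the umbilicity function, such that $-\overline\nabla_XN=\varrho X$ for all $X$ tangent to $\Sigma$. Let $c_0>0$ and $c>0$ be constants and put $$F_1(t)=\frac{e^{-\sqrt{c_0}\,t}}{4c_0c}\left[c^2e^{2\sqrt{c_0}\,t}-4c_0\kappa\right],\qquad F_2(t)=\frac{e^{-\sqrt{c_0}\,t}}{4c_0c}\left[c^2-4c_0\kappa\, e^{2\sqrt{c_0}\,t}\right].$$ For $i=1,2$ the function $F_i$ is smooth on $\mathbb R$, and $I_i=\{t\in\mathbb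 R: F_i(t)>0\}$ is a non-empty open interval, equal to $\mathbb R$ if $\kappa\le 0$. The function $f_i=\ln F_i$ is smooth on $I_i$ and satisfies $f_i''+\kappa e^{-2f_i}=0$ there. Moreover, for every totally umbilical immersion of a connected surface $\Sigma$ into $\mathbb M(\kappa)_{f_i}\times I_i$, the umbilicity function $\varrho$ is constant. -/

import Mathlib

open scoped Manifold ContDiff

noncomputable section

namespace UmbilicalWarped

/-- The linear space `ℝ³ × ℝ` that contains every `𝕄(κ) × I`. -/
abbrev Amb : Type := (Fin 3 → ℝ) × ℝ

/-- The bilinear form `x₀y₀ + x₁y₁ + κ x₂y₂` on `ℝ³`: Euclidean for `κ = 1`, Lorentzian for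
`κ = -1`, and the Euclidean product of the first two coordinates for `κ = 0`. -/
def form (κ : ℝ) (v w : Fin 3 → ℝ) : ℝ := v 0 * w 0 + v 1 * w 1 + κ * (v 2 * w 2)

/-- The simply connected complete space form `𝕄(κ)`, `κ ∈ {-1, 0, 1}`, as a surface in `ℝ³`:
the unit sphere `x₀² + x₁² + x₂² = 1` for `κ = 1`, the plane `x₂ = 1` for `κ = 0`, and the sheet
`x₂ > 0` of the hyperboloid `x₂² - x₀² - x₁² = 1` for `κ = -1`.
Its Riemannian metric `g₂` is the restriction of `form κ` to the tangent planes. -/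
def spaceForm (κ : ℝ) : Set (Fin 3 → ℝ) :=
  {x | κ * (x 0 ^ 2 + x 1 ^ 2) + x 2 ^ 2 = 1 ∧ (κ ≤ 0 → 0 < x 2)}

/-- The underlying set of the warped product: `𝕄(κ) × I`. -/
def warpedProduct (κ : ℝ) (I : Set ℝ) : Set Amb := {q | q.1 ∈ spaceForm κ ∧ q.2 ∈ I}

/-- `w` is tangent to `𝕄(κ) × I` at `q`: its first component is annihilated by the
differential of the equation that defines `𝕄(κ)`. -/
def IsTangent (κ : ℝ) (q w : Amb) : Prop :=
  κ * (q.1 0 * w.1 0 + q.1 1 * w.1 1) + q.1 2 * w.1 2 = 0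

/-- The warped metric `ḡ = e^{2f} g₂ + dt²` at the point `q = (x, t)`. -/
def metric (κ : ℝ) (f : ℝ → ℝ) (q v w : Amb) : ℝ :=
  Real.exp (2 * f q.2) * form κ v.1 w.1 + v.2 * w.2

variable {S : Type*} [TopologicalSpace S] [ChartedSpace (EuclideanSpace ℝ (Fin 2)) S]

/-- The differential `dφ_p(v)` of a map `φ : S → ℝ³ × ℝ` on the surface `S`. -/
def diff (φ : S → Amb) (p : S) (v : TangentSpace (𝓡 2) p) : Amb :=
  mfderiv (𝓡 2) 𝓘(ℝ, Amb) φ p v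

/-- `w = ∇̄_v N` at `p`, where `∇̄` is the Levi-Civita connection of `(𝕄(κ) × I, ḡ)`, the map `φ`
goes from `S` into `𝕄(κ) × I`, `N` is a vector field along `φ`, tangent to `𝕄(κ) × I`, and `v` is
a tangent vector of `S` at `p`.
This is the Koszul formula: for vector fields `X, Y, Z` on `ℝ³ × ℝ` that are tangent to
`𝕄(κ) × I`, the right side of
`2 ḡ(∇̄_X Y, Z) = X ḡ(Y,Z) + Y ḡ(X,Z) - Z ḡ(X,Y) + ḡ([X,Y],Z) - ḡ([X,Z],Y) - ḡ([Y,Z],X)`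
equals `2 ḡ(DY(X), Z) + (∂_X ḡ)(Y,Z) + (∂_Y ḡ)(X,Z) - (∂_Z ḡ)(X,Y)`, where `D` is the derivative
of vector-valued maps and `∂_X ḡ` is the derivative of the coefficients of `ḡ` in the linear
coordinates. Since `ḡ` is positive definite on the tangent spaces of `𝕄(κ) × I`, at most one `w`
satisfies this. -/
def IsCovDeriv (κ : ℝ) (f : ℝ → ℝ) (φ N : S → Amb) (p : S) (v : TangentSpace (𝓡 2) p)
    (w : Amb) : Prop :=
  IsTangent κ (φ p) w ∧
  ∀ z : Amb, IsTangent κ (φ p) z →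
    metric κ f (φ p) w z =
      metric κ f (φ p) (diff N p v) z +
        (fderiv ℝ (fun q => metric κ f q (N p) z) (φ p) (diff φ p v) +
          fderiv ℝ (fun q => metric κ f q (diff φ p v) z) (φ p) (N p) -
          fderiv ℝ (fun q => metric κ f q (diff φ p v) (N p)) (φ p) z) / 2

/-- `φ : S → 𝕄(κ) × I` is a smooth immersion of the surface `S` into the warped product
`𝕄(κ)_f × I`, `N` is a smooth unit normal field along it, and the surface is totally umbilical
with umbilicity function `ρ`: `-∇̄_v N = ρ v` for all tangent vectors `v` of the surface. -/
structure IsTotallyUmbilical (κ : ℝ) (f : ℝ → ℝ) (I : Set ℝ) (φ N : S → Amb) (ρ : S → ℝ) :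
    Prop where
  contMDiff_map : ContMDiff (𝓡 2) 𝓘(ℝ, Amb) ∞ φ
  mem : ∀ p, φ p ∈ warpedProduct κ I
  immersion : ∀ p, Function.Injective (mfderiv (𝓡 2) 𝓘(ℝ, Amb) φ p)
  contMDiff_normal : ContMDiff (𝓡 2) 𝓘(ℝ, Amb) ∞ N
  tangent : ∀ p, IsTangent κ (φ p) (N p)
  normal : ∀ p v, metric κ f (φ p) (N p) (diff φ p v) = 0
  unit : ∀ p, metric κ f (φ p) (N p) (N p) = 1
  contMDiff_umbilicity : ContMDiff (𝓡 2) 𝓘(ℝ, ℝ) ∞ ρ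
  umbilic : ∀ p v, IsCovDeriv κ f φ N p v (-(ρ p • diff φ p v))

/-- `F₁(t) = e^{-√c₀ t} / (4 c₀ c) · (c² e^{2√c₀ t} - 4 c₀ κ)`. -/
def F₁ (κ c₀ c t : ℝ) : ℝ :=
  Real.exp (-(√c₀ * t)) / (4 * c₀ * c) * (c ^ 2 * Real.exp (2 * √c₀ * t) - 4 * c₀ * κ)

/-- `F₂(t) = e^{-√c₀ t} / (4 c₀ c) · (c² - 4 c₀ e^{2√c₀ t} κ)`. -/
def F₂ (κ c₀ c t : ℝ) : ℝ :=
  Real.exp (-(√c₀ * t)) / (4 * c₀ * c) * (c ^ 2 - 4 * c₀ * Real.exp (2 * √c₀ * t) * κ)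

end UmbilicalWarped

end

namespace UmbilicalWarped

/-! Both `F₁` and `F₂` satisfy `F'' = c₀ F` and `F'² = c₀ F² + κ`, so the warped product has
constant curvature `-c₀` and can be developed into the flat space `ℝ³ × ℝ` by `(x, t) ↦ (F x, F')`.
For `κ = ±1` this is an isometric map into the quadric `form κ - κ s² / c₀ = -1 / c₀`; for `κ = 0`
the ambient form degenerates, but the linear identities used below persist.

Let `Φ` be the developed surface and `W` the developed normal. Since `N` is orthogonal to the
surface, the flat derivative of `W` has no component along the position vector, and umbilicity
becomes `dW = -ρ dΦ` (`components_of_koszul`, `flat_components`). Symmetry of second derivatives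
then gives `dρ ∧ dΦ = 0`, which forces `dρ = 0` in dimension two
(`fderiv_eq_zero_of_fderiv_eq_neg_smul`). Charts turn this into local constancy, and connectedness
finishes. -/

/-! ### Umbilicity in a flat space -/

/-- If `dW = -ρ dΦ` with `dΦ` injective on an open subset of a plane, then `dρ = 0`. -/
theorem fderiv_eq_zero_of_fderiv_eq_neg_smul {E G : Type*} [NormedAddCommGroup E]
    [NormedSpace ℝ E] [NormedAddCommGroup G] [NormedSpace ℝ G]
    (hE : 1 < Module.finrank ℝ E) {U : Set E} (hU : IsOpen U)
    {Φ W : E → G} {ρ : E → ℝ} (hΦ : ContDiffOn ℝ 2 Φ U) (hW : ContDiffOn ℝ 2 W U)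
    (hρ : ContDiffOn ℝ 1 ρ U) (h : ∀ y ∈ U, fderiv ℝ W y = -(ρ y) • fderiv ℝ Φ y)
    (hinj : ∀ y ∈ U, Function.Injective (fderiv ℝ Φ y)) {y : E} (hy : y ∈ U) :
    fderiv ℝ ρ y = 0 := by
  have hUy := hU.mem_nhds hy
  have hΦ2 : IsSymmSndFDerivAt ℝ Φ y :=
    (hΦ.contDiffAt hUy).isSymmSndFDerivAt (by simp)
  have hW2 : IsSymmSndFDerivAt ℝ W y :=
    (hW.contDiffAt hUy).isSymmSndFDerivAt (by simp)
  have hdΦ : DifferentiableAt ℝ (fderiv ℝ Φ) y :=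
    ((hΦ.contDiffAt hUy).fderiv_right (m := 1) (by norm_num)).differentiableAt (by simp)
  have hdρ : DifferentiableAt ℝ ρ y := (hρ.contDiffAt hUy).differentiableAt (by simp)
  have hev : fderiv ℝ W =ᶠ[nhds y] fun y => -(ρ y) • fderiv ℝ Φ y := by
    filter_upwards [hUy] with z hz using h z hz
  have hd2 : ∀ v w, fderiv ℝ (fderiv ℝ W) y v w =
      -(ρ y) • fderiv ℝ (fderiv ℝ Φ) y v w - fderiv ℝ ρ y v • fderiv ℝ Φ y w := by
    intro v w
    have hW' : HasFDerivAt (fderiv ℝ W) _ y :=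
      (hdρ.hasFDerivAt.neg.smul hdΦ.hasFDerivAt).congr_of_eventuallyEq hev
    rw [hW'.fderiv]
    simp [sub_eq_add_neg]
  -- Antisymmetrising `d²W` cancels `d²Φ` and leaves `dρ(v) dΦ(w) = dρ(w) dΦ(v)`; injectivity of
  -- `dΦ` removes `dΦ`.
  have hsymm : ∀ v w, fderiv ℝ ρ y v • w = fderiv ℝ ρ y w • v := by
    intro v w
    apply hinj y hy
    have h1 := hW2.eq v w
    rw [hd2, hd2, hΦ2.eq v w] at h1
    simpa using sub_right_injective h1
  by_contra hne
  obtain ⟨v, hv⟩ : ∃ v, fderiv ℝ ρ y v ≠ 0 := by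
    by_contra! hall
    exact hne (ContinuousLinearMap.ext hall)
  refine absurd (finrank_le_one v fun w => ⟨(fderiv ℝ ρ y v)⁻¹ * fderiv ℝ ρ y w, ?_⟩) hE.not_ge
  rw [mul_smul, ← hsymm, smul_smul, inv_mul_cancel₀ hv, one_smul]

/-! ### Pointwise algebra of the Koszul formula -/

/-- Definiteness of `g₂`, needed to recover a vector from its products with tangent vectors. -/
theorem form_eq_zero_of_isTangent {κ : ℝ} (hκ : κ = -1 ∨ κ = 0 ∨ κ = 1) {q w : Amb}
    (hq : q.1 ∈ spaceForm κ) (hw : IsTangent κ q w) (h : form κ w.1 w.1 = 0) : w.1 = 0 := by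
  obtain ⟨x, t⟩ := q
  obtain ⟨u, s⟩ := w
  obtain ⟨hx, hpos⟩ := hq
  simp only [IsTangent, form] at *
  have key : u 0 = 0 ∧ u 1 = 0 ∧ u 2 = 0 := by
    rcases hκ with rfl | rfl | rfl
    · have hp := hpos (by norm_num)
      have h2 : x 2 * u 2 = x 0 * u 0 + x 1 * u 1 := by linarith
      -- Lagrange's identity in the first two coordinates, combined with `x₂² = 1 + x₀² + x₁²`.
      have h3 : u 0 ^ 2 + u 1 ^ 2 + (x 0 * u 1 - x 1 * u 0) ^ 2 = 0 := by
        linear_combination (x 2 * u 2 + x 0 * u 0 + x 1 * u 1) * h2 + x 2 ^ 2 * h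
          - (u 0 ^ 2 + u 1 ^ 2) * hx
      have h0 : u 0 = 0 := by nlinarith [sq_nonneg (u 1), sq_nonneg (x 0 * u 1 - x 1 * u 0)]
      have h1 : u 1 = 0 := by nlinarith [sq_nonneg (u 0), sq_nonneg (x 0 * u 1 - x 1 * u 0)]
      refine ⟨h0, h1, ?_⟩
      rw [h0, h1] at h2
      simpa [hp.ne'] using h2
    · have hp := hpos le_rfl
      refine ⟨by nlinarith [sq_nonneg (u 0), sq_nonneg (u 1)],
        by nlinarith [sq_nonneg (u 0), sq_nonneg (u 1)], ?_⟩
      simpa [hp.ne'] using hw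
    · refine ⟨?_, ?_, ?_⟩ <;>
        nlinarith [sq_nonneg (u 0), sq_nonneg (u 1), sq_nonneg (u 2)]
  funext i
  fin_cases i
  exacts [key.1, key.2.1, key.2.2]

theorem fderiv_metric (κ : ℝ) {f : ℝ → ℝ} {f' : ℝ} (a b q w : Amb)
    (hf : HasDerivAt f f' q.2) :
    fderiv ℝ (fun q => metric κ f q a b) q w =
      2 * f' * Real.exp (2 * f q.2) * w.2 * form κ a.1 b.1 := by
  have h1 : HasFDerivAt (fun q : Amb => f q.2) (f' • ContinuousLinearMap.snd ℝ _ _) q :=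
    hf.comp_hasFDerivAt q hasFDerivAt_snd
  have h2 : HasFDerivAt (fun q => metric κ f q a b) _ q :=
    (((h1.const_mul 2).exp).mul_const (form κ a.1 b.1)).add_const (a.2 * b.2)
  rw [h2.fderiv]
  simp
  ring

/-- The components of the equation `∇̄_v N = -r v` in `ℝ³ × ℝ`, where `v = V`, `N = n`, and `M` is
the derivative of `N` in the direction `v`. -/
theorem components_of_koszul {κ : ℝ} (hκ : κ = -1 ∨ κ = 0 ∨ κ = 1) {f : ℝ → ℝ} {f' r : ℝ}
    {q n V M : Amb} (hf : HasDerivAt f f' q.2) (hq : q.1 ∈ spaceForm κ)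
    (hn : IsTangent κ q n) (hV : IsTangent κ q V)
    (hM : κ * (V.1 0 * n.1 0 + V.1 1 * n.1 1) + V.1 2 * n.1 2 +
      (κ * (q.1 0 * M.1 0 + q.1 1 * M.1 1) + q.1 2 * M.1 2) = 0)
    (h : ∀ z : Amb, IsTangent κ q z →
      metric κ f q (-(r • V)) z = metric κ f q M z +
        (fderiv ℝ (fun q => metric κ f q n z) q V + fderiv ℝ (fun q => metric κ f q V z) q n -
          fderiv ℝ (fun q => metric κ f q V n) q z) / 2) :
    (∀ i, M.1 i + κ * form κ V.1 n.1 * q.1 i + f' * V.2 * n.1 i + f' * n.2 * V.1 i =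
      -r * V.1 i) ∧
    M.2 - f' * Real.exp (2 * f q.2) * form κ V.1 n.1 = -r * V.2 := by
  have hz : ∀ z : Amb, IsTangent κ q z →
      Real.exp (2 * f q.2) * form κ (-(r • V)).1 z.1 + -(r * V.2) * z.2 =
      Real.exp (2 * f q.2) * form κ M.1 z.1 + M.2 * z.2 +
        f' * Real.exp (2 * f q.2) * (V.2 * form κ n.1 z.1 + n.2 * form κ V.1 z.1 -
          z.2 * form κ V.1 n.1) := by
    intro z hz
    have := h z hz
    rw [fderiv_metric κ _ _ _ _ hf, fderiv_metric κ _ _ _ _ hf, fderiv_metric κ _ _ _ _ hf] at this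
    simp only [metric, Prod.snd_neg, Prod.smul_snd, smul_eq_mul] at this
    linarith
  constructor
  -- `u` is the horizontal part of `∇̄_v N + r v`; its `κ` term is the normal correction of `𝕄(κ)`
  -- in `ℝ³`. Since `u` is tangent, it can be tested against itself, and definiteness gives `u = 0`.
  · set u : Fin 3 → ℝ := fun i => M.1 i + κ * form κ V.1 n.1 * q.1 i + f' * V.2 * n.1 i +
      f' * n.2 * V.1 i + r * V.1 i with hu
    have hκ3 : κ ^ 3 = κ := by rcases hκ with rfl | rfl | rfl <;> norm_num
    have hn2 : κ ^ 2 * (V.1 2 * n.1 2) = V.1 2 * n.1 2 := by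
      rcases hκ with rfl | rfl | rfl
      · norm_num
      · have := hq.2 le_rfl
        have hn' := hn
        simp only [IsTangent] at hn'
        have : n.1 2 = 0 := by simpa [this.ne'] using hn'
        simp [this]
      · norm_num
    have hut : IsTangent κ q (u, 0) := by
      have h1 := hq.1
      simp only [IsTangent] at hn hV ⊢
      simp only [hu, form]
      linear_combination hM + f' * V.2 * hn + (f' * n.2 + r) * hV +
        κ * (V.1 0 * n.1 0 + V.1 1 * n.1 1 + κ * (V.1 2 * n.1 2)) * h1 + hn2
    have h2 := hz _ hut
    have hκu : κ * form κ q.1 u = 0 := by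
      simp only [IsTangent] at hut
      rcases hκ with rfl | rfl | rfl
      · simp only [form]; linarith
      · simp
      · simp only [form]; linarith
    have huu : form κ u u = 0 := by
      have hlin : form κ u u = form κ M.1 u + form κ V.1 n.1 * (κ * form κ q.1 u) +
          f' * V.2 * form κ n.1 u + f' * n.2 * form κ V.1 u - form κ (-(r • V)).1 u := by
        simp only [form, hu, Prod.fst_neg, Prod.smul_fst, Pi.neg_apply, Pi.smul_apply, smul_eq_mul]
        ring
      rw [hlin, hκu]
      apply mul_left_cancel₀ (Real.exp_ne_zero (2 * f q.2))
      simp only at h2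
      linear_combination -h2
    have hu0 := form_eq_zero_of_isTangent hκ hq hut huu
    intro i
    have := congrFun hu0 i
    simp only [hu, Pi.zero_apply] at this
    linarith
  -- Testing against `∂_t` isolates the vertical component.
  · have := hz (0, 1) (by simp [IsTangent])
    simp [form] at this
    simp only [form]
    linarith

/-- For a warping function with `F'' = c₀ F` and `F'² = c₀ F² + κ` (where `a = F`, `g = F'` at the
point), the equation `∇̄_v N = -r v` says that the derivative of `(F n + F' ν x, F ν)` is `-r` times
the derivative of `(F x, F' / c₀)`. -/
theorem flat_components {κ c₀ a g r : ℝ} (ha : 0 < a)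
    (hg : g ^ 2 = c₀ * a ^ 2 + κ) {q n V M : Amb}
    (hnormal : a ^ 2 * form κ n.1 V.1 + n.2 * V.2 = 0)
    (h : (∀ i, M.1 i + κ * form κ V.1 n.1 * q.1 i + g / a * V.2 * n.1 i + g / a * n.2 * V.1 i =
      -r * V.1 i) ∧ M.2 - g / a * a ^ 2 * form κ V.1 n.1 = -r * V.2) :
    a • M.1 + (g * V.2) • n.1 + (g * n.2) • V.1 + (g * M.2 + c₀ * a * V.2 * n.2) • q.1 =
      -r • (a • V.1 + (g * V.2) • q.1) ∧
    a * M.2 + g * V.2 * n.2 = -r * (a * V.2) := by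
  have hs : form κ V.1 n.1 = -(n.2 * V.2) / a ^ 2 := by
    have : form κ V.1 n.1 = form κ n.1 V.1 := by simp only [form]; ring
    rw [this]
    field_simp
    linarith
  obtain ⟨h1, h2⟩ := h
  rw [hs] at h2
  have h3 : a * M.2 + g * V.2 * n.2 = -r * (a * V.2) := by
    field_simp at h2
    linear_combination h2
  refine ⟨funext fun i => ?_, h3⟩
  have h4 := h1 i
  rw [hs] at h4
  field_simp at h4
  simp only [Pi.add_apply, Pi.smul_apply, smul_eq_mul]
  apply mul_left_cancel₀ ha.ne'
  -- The relation `g² = c₀ a² + κ` trades the curvature term of `𝕄(κ)` for the second derivative `c₀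
  -- a` of the warping function.
  linear_combination h4 + g * q.1 i * h3 - V.2 * n.2 * q.1 i * hg

/-! ### The developed surface in a parameter domain -/

section Flat

variable {E : Type*} [NormedAddCommGroup E] [NormedSpace ℝ E] {F G : ℝ → ℝ} {c₀ : ℝ}
  {φ N : E → Amb} {φ' N' : E →L[ℝ] Amb} {y : E}

theorem fderiv_flat_map (hF : HasDerivAt F (G (φ y).2) (φ y).2)
    (hG : HasDerivAt G (c₀ * F (φ y).2) (φ y).2) (hφ : HasFDerivAt φ φ' y) (v : E) :
    fderiv ℝ (fun y => (F (φ y).2 • (φ y).1, G (φ y).2)) y v =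
      (F (φ y).2 • (φ' v).1 + (G (φ y).2 * (φ' v).2) • (φ y).1,
        c₀ * (F (φ y).2 * (φ' v).2)) := by
  have h : HasFDerivAt (fun y => (F (φ y).2 • (φ y).1, G (φ y).2)) _ y :=
    ((hF.comp_hasFDerivAt y hφ.snd).smul hφ.fst).prodMk (hG.comp_hasFDerivAt y hφ.snd)
  rw [h.fderiv]
  simp [mul_assoc]

/-- The map differentiated here is the differential of the development applied to `N`: it is
`fderiv_flat_map` with `N y` in place of `φ' v`. -/
theorem fderiv_flat_normal (hF : HasDerivAt F (G (φ y).2) (φ y).2)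
    (hG : HasDerivAt G (c₀ * F (φ y).2) (φ y).2) (hφ : HasFDerivAt φ φ' y)
    (hN : HasFDerivAt N N' y) (v : E) :
    fderiv ℝ (fun y => (F (φ y).2 • (N y).1 + (G (φ y).2 * (N y).2) • (φ y).1,
        c₀ * (F (φ y).2 * (N y).2))) y v =
      (F (φ y).2 • (N' v).1 + (G (φ y).2 * (φ' v).2) • (N y).1 +
          (G (φ y).2 * (N y).2) • (φ' v).1 +
          (G (φ y).2 * (N' v).2 + c₀ * F (φ y).2 * (φ' v).2 * (N y).2) • (φ y).1,
        c₀ * (F (φ y).2 * (N' v).2 + G (φ y).2 * (φ' v).2 * (N y).2)) := by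
  have hF' := hF.comp_hasFDerivAt y hφ.snd
  have hG' := hG.comp_hasFDerivAt y hφ.snd
  have h : HasFDerivAt (fun y => (F (φ y).2 • (N y).1 + (G (φ y).2 * (N y).2) • (φ y).1,
        c₀ * (F (φ y).2 * (N y).2))) _ y :=
    ((hF'.smul hN.fst).add ((hG'.mul hN.snd).smul hφ.fst)).prodMk
      ((hF'.mul hN.snd).const_mul c₀)
  rw [h.fderiv]
  ext
  · simp
    ring
  · simp
    ring

variable {κ : ℝ} {f : ℝ → ℝ} {I : Set ℝ} {U : Set E} {ρ : E → ℝ}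

theorem isTangent_fderiv (hU : IsOpen U) (hy : y ∈ U) (hφ : HasFDerivAt φ φ' y)
    (hmem : ∀ y ∈ U, φ y ∈ warpedProduct κ I) (v : E) : IsTangent κ (φ y) (φ' v) := by
  have hx : ∀ i, HasFDerivAt (fun y => (φ y).1 i) _ y := fun i => hasFDerivAt_pi'.1 hφ.fst i
  have h : HasFDerivAt (fun y => κ * ((φ y).1 0 ^ 2 + (φ y).1 1 ^ 2) + (φ y).1 2 ^ 2) _ y :=
    ((((hx 0).pow 2).add ((hx 1).pow 2)).const_mul κ).add ((hx 2).pow 2)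
  have hev : (fun y => κ * ((φ y).1 0 ^ 2 + (φ y).1 1 ^ 2) + (φ y).1 2 ^ 2) =ᶠ[nhds y]
      fun _ => (1 : ℝ) := by
    filter_upwards [hU.mem_nhds hy] with z hz using (hmem z hz).1.1
  have h0 := DFunLike.congr_fun (h.unique ((hasFDerivAt_const (1 : ℝ) y).congr_of_eventuallyEq hev)) v
  simp at h0
  simp only [IsTangent]
  linarith

theorem isTangent_derivative (hU : IsOpen U) (hy : y ∈ U) (hφ : HasFDerivAt φ φ' y)
    (hN : HasFDerivAt N N' y) (htan : ∀ y ∈ U, IsTangent κ (φ y) (N y)) (v : E) :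
    κ * ((φ' v).1 0 * (N y).1 0 + (φ' v).1 1 * (N y).1 1) + (φ' v).1 2 * (N y).1 2 +
      (κ * ((φ y).1 0 * (N' v).1 0 + (φ y).1 1 * (N' v).1 1) + (φ y).1 2 * (N' v).1 2) = 0 := by
  have hx : ∀ i, HasFDerivAt (fun y => (φ y).1 i) _ y := fun i => hasFDerivAt_pi'.1 hφ.fst i
  have hn : ∀ i, HasFDerivAt (fun y => (N y).1 i) _ y := fun i => hasFDerivAt_pi'.1 hN.fst i
  have h : HasFDerivAt (fun y => κ * ((φ y).1 0 * (N y).1 0 + (φ y).1 1 * (N y).1 1) +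
      (φ y).1 2 * (N y).1 2) _ y :=
    ((((hx 0).mul (hn 0)).add ((hx 1).mul (hn 1))).const_mul κ).add ((hx 2).mul (hn 2))
  have hev : (fun y => κ * ((φ y).1 0 * (N y).1 0 + (φ y).1 1 * (N y).1 1) +
      (φ y).1 2 * (N y).1 2) =ᶠ[nhds y] fun _ => (0 : ℝ) := by
    filter_upwards [hU.mem_nhds hy] with z hz using htan z hz
  have h0 := DFunLike.congr_fun (h.unique ((hasFDerivAt_const (0 : ℝ) y).congr_of_eventuallyEq hev)) v
  simp at h0
  linarith

/-- The umbilicity function of a parametrized totally umbilical surface is locally constant if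
the warping function satisfies `F'' = c₀ F` and `F'² = c₀ F² + κ`. -/
theorem fderiv_umbilicity_eq_zero (hE : 1 < Module.finrank ℝ E)
    (hκ : κ = -1 ∨ κ = 0 ∨ κ = 1) (hc₀ : 0 < c₀)
    (hFs : ContDiff ℝ ∞ F) (hGs : ContDiff ℝ ∞ G) (hF : ∀ t, HasDerivAt F (G t) t)
    (hG : ∀ t, HasDerivAt G (c₀ * F t) t) (hFG : ∀ t, G t ^ 2 = c₀ * F t ^ 2 + κ)
    (hpos : ∀ t ∈ I, 0 < F t) (hf : f = fun t => Real.log (F t)) (hU : IsOpen U)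
    (hφ : ContDiffOn ℝ ∞ φ U) (hN : ContDiffOn ℝ ∞ N U) (hρ : ContDiffOn ℝ ∞ ρ U)
    (hmem : ∀ y ∈ U, φ y ∈ warpedProduct κ I)
    (himm : ∀ y ∈ U, Function.Injective (fderiv ℝ φ y))
    (htan : ∀ y ∈ U, IsTangent κ (φ y) (N y))
    (hnormal : ∀ y ∈ U, ∀ v, metric κ f (φ y) (N y) (fderiv ℝ φ y v) = 0)
    (humb : ∀ y ∈ U, ∀ v z, IsTangent κ (φ y) z →
      metric κ f (φ y) (-(ρ y • fderiv ℝ φ y v)) z = metric κ f (φ y) (fderiv ℝ N y v) z +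
        (fderiv ℝ (fun q => metric κ f q (N y) z) (φ y) (fderiv ℝ φ y v) +
          fderiv ℝ (fun q => metric κ f q (fderiv ℝ φ y v) z) (φ y) (N y) -
          fderiv ℝ (fun q => metric κ f q (fderiv ℝ φ y v) (N y)) (φ y) z) / 2)
    (hy : y ∈ U) : fderiv ℝ ρ y = 0 := by
  have hdφ : ∀ y ∈ U, HasFDerivAt φ (fderiv ℝ φ y) y := fun y hy =>
    ((hφ.contDiffAt (hU.mem_nhds hy)).differentiableAt (by simp)).hasFDerivAt
  have hdN : ∀ y ∈ U, HasFDerivAt N (fderiv ℝ N y) y := fun y hy =>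
    ((hN.contDiffAt (hU.mem_nhds hy)).differentiableAt (by simp)).hasFDerivAt
  have h2 : (2 : ℕ∞ω) ≤ ∞ := WithTop.coe_le_coe.2 le_top
  have h1 : (1 : ℕ∞ω) ≤ ∞ := WithTop.coe_le_coe.2 le_top
  have hFφ : ContDiffOn ℝ ∞ (fun y => F (φ y).2) U := hFs.comp_contDiffOn hφ.snd
  have hGφ : ContDiffOn ℝ ∞ (fun y => G (φ y).2) U := hGs.comp_contDiffOn hφ.snd
  refine fderiv_eq_zero_of_fderiv_eq_neg_smul hE hU
    (Φ := fun y => (F (φ y).2 • (φ y).1, G (φ y).2))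
    (W := fun y => (F (φ y).2 • (N y).1 + (G (φ y).2 * (N y).2) • (φ y).1,
        c₀ * (F (φ y).2 * (N y).2)))
    (((hFφ.smul hφ.fst).prodMk hGφ).of_le h2)
    ((((hFφ.smul hN.fst).add ((hGφ.mul hN.snd).smul hφ.fst)).prodMk
      (contDiffOn_const.mul (hFφ.mul hN.snd))).of_le h2) (hρ.of_le h1) ?_ ?_ hy
  · intro y hy
    ext1 v
    have hFp := hpos _ (hmem y hy).2
    have hexp : Real.exp (2 * f (φ y).2) = F (φ y).2 ^ 2 := by
      rw [hf, two_mul, Real.exp_add, Real.exp_log hFp, sq]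
    have hdf : HasDerivAt f (G (φ y).2 / F (φ y).2) (φ y).2 := by
      rw [hf]; exact (hF _).log hFp.ne'
    have hcomp := components_of_koszul hκ hdf (hmem y hy).1 (htan y hy)
      (isTangent_fderiv hU hy (hdφ y hy) hmem v)
      (isTangent_derivative hU hy (hdφ y hy) (hdN y hy) htan v) (humb y hy v)
    have hnor := hnormal y hy v
    simp only [metric] at hnor
    rw [hexp] at hcomp hnor
    obtain ⟨e1, e2⟩ := flat_components hFp (hFG (φ y).2) hnor hcomp
    rw [fderiv_flat_normal (hF _) (hG _) (hdφ y hy) (hdN y hy), e1, e2,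
      smul_apply, fderiv_flat_map (hF _) (hG _) (hdφ y hy), Prod.smul_mk,
      smul_eq_mul]
    congr 1
    ring
  -- The development is an immersion: its last component detects `dt` because `c₀ F ≠ 0`, and once
  -- `dt` vanishes the rest is `F dx`.
  · intro y hy
    rw [injective_iff_map_eq_zero]
    intro v hv
    rw [fderiv_flat_map (hF _) (hG _) (hdφ y hy)] at hv
    have hFp := hpos _ (hmem y hy).2
    simp only [Prod.mk_eq_zero, mul_eq_zero, hc₀.ne', hFp.ne', false_or] at hv
    obtain ⟨ha, hb⟩ := hv
    rw [hb, mul_zero, zero_smul, add_zero, smul_eq_zero] at ha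
    exact (injective_iff_map_eq_zero _).1 (himm y hy) v
      (Prod.ext (ha.resolve_left hFp.ne') hb)

end Flat

/-! ### The warping functions and their positivity intervals -/

/-- `A e^{st} + B e^{-st}`. -/
noncomputable def expSum (s A B t : ℝ) : ℝ := A * Real.exp (s * t) + B * Real.exp (-(s * t))

theorem contDiff_expSum (s A B : ℝ) : ContDiff ℝ ∞ (expSum s A B) := by
  unfold expSum
  fun_prop

theorem hasDerivAt_expSum (s A B t : ℝ) :
    HasDerivAt (expSum s A B) (expSum s (s * A) (-(s * B)) t) t := by
  have h1 : HasDerivAt (fun t => s * t) s t := by simpa using (hasDerivAt_id t).const_mul s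
  have h : HasDerivAt (expSum s A B) _ t :=
    (h1.exp.const_mul A).add (h1.neg.exp.const_mul B)
  convert h using 1
  simp only [expSum, Pi.neg_apply]
  ring

theorem F₁_eq_expSum (κ : ℝ) {c₀ c : ℝ} (hc₀ : 0 < c₀) (hc : 0 < c) :
    F₁ κ c₀ c = expSum √c₀ (c / (4 * c₀)) (-κ / c) := by
  funext t
  have h : Real.exp (2 * √c₀ * t) = Real.exp (√c₀ * t) ^ 2 := by
    rw [sq, ← Real.exp_add]; ring_nf
  simp only [F₁, expSum]
  rw [h, Real.exp_neg]
  have := Real.exp_pos (√c₀ * t)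
  field_simp
  ring

theorem F₂_eq_expSum (κ : ℝ) {c₀ c : ℝ} (hc₀ : 0 < c₀) (hc : 0 < c) :
    F₂ κ c₀ c = expSum √c₀ (-κ / c) (c / (4 * c₀)) := by
  funext t
  have h : Real.exp (2 * √c₀ * t) = Real.exp (√c₀ * t) ^ 2 := by
    rw [sq, ← Real.exp_add]; ring_nf
  simp only [F₂, expSum]
  rw [h, Real.exp_neg]
  have := Real.exp_pos (√c₀ * t)
  field_simp
  ring

theorem exists_eq_expSum {κ c₀ c : ℝ} {F : ℝ → ℝ} (hc₀ : 0 < c₀) (hc : 0 < c)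
    (hF : F = F₁ κ c₀ c ∨ F = F₂ κ c₀ c) :
    ∃ A B, F = expSum √c₀ A B ∧ 4 * c₀ * (A * B) = -κ := by
  rcases hF with rfl | rfl
  · exact ⟨_, _, F₁_eq_expSum κ hc₀ hc, by field_simp⟩
  · exact ⟨_, _, F₂_eq_expSum κ hc₀ hc, by field_simp⟩

/-- The difference `F'² - c₀ F²` is a first integral of `F'' = c₀ F`, with value `-4 c₀ A B`. -/
theorem expSum_sq {κ c₀ A B : ℝ} (hc₀ : 0 < c₀) (h : 4 * c₀ * (A * B) = -κ) (t : ℝ) :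
    expSum √c₀ (√c₀ * A) (-(√c₀ * B)) t ^ 2 = c₀ * expSum √c₀ A B t ^ 2 + κ := by
  have hs := Real.sq_sqrt hc₀.le
  have he : Real.exp (√c₀ * t) * Real.exp (-(√c₀ * t)) = 1 := by
    rw [← Real.exp_add, add_neg_cancel, Real.exp_zero]
  simp only [expSum]
  linear_combination (A * Real.exp (√c₀ * t) - B * Real.exp (-(√c₀ * t))) ^ 2 * hs -
    4 * c₀ * A * B * he - h

theorem F₁_pos_iff {κ c₀ c : ℝ} (hc₀ : 0 < c₀) (hc : 0 < c) (t : ℝ) :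
    0 < F₁ κ c₀ c t ↔ 4 * c₀ * κ < c ^ 2 * Real.exp (2 * √c₀ * t) := by
  rw [F₁, mul_pos_iff_of_pos_left (by positivity), sub_pos]

theorem F₂_pos_iff {κ c₀ c : ℝ} (hc₀ : 0 < c₀) (hc : 0 < c) (t : ℝ) :
    0 < F₂ κ c₀ c t ↔ 4 * c₀ * Real.exp (2 * √c₀ * t) * κ < c ^ 2 := by
  rw [F₂, mul_pos_iff_of_pos_left (by positivity), sub_pos]

theorem nonempty_setOf_pos {κ c₀ c : ℝ} (hκ : κ ≤ 1) (hc₀ : 0 < c₀) (hc : 0 < c) {F : ℝ → ℝ}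
    (hF : F = F₁ κ c₀ c ∨ F = F₂ κ c₀ c) : {t | 0 < F t}.Nonempty := by
  have hs : 0 < √c₀ := Real.sqrt_pos.2 hc₀
  have hpos : 0 < 4 * c₀ / c ^ 2 + 1 := by positivity
  rcases hF with rfl | rfl
  -- At this `t`, `c² e^{2√c₀ t} = 4 c₀ + c²`, which exceeds `4 c₀ κ`. The opposite `t` serves `F₂`.
  · refine ⟨Real.log (4 * c₀ / c ^ 2 + 1) / (2 * √c₀), (F₁_pos_iff hc₀ hc _).2 ?_⟩
    rw [mul_div_cancel₀ _ (by positivity), Real.exp_log hpos]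
    have : c ^ 2 * (4 * c₀ / c ^ 2 + 1) = 4 * c₀ + c ^ 2 := by field_simp
    nlinarith [sq_pos_of_pos hc]
  · refine ⟨-(Real.log (4 * c₀ / c ^ 2 + 1) / (2 * √c₀)), (F₂_pos_iff hc₀ hc _).2 ?_⟩
    rw [mul_neg, mul_div_cancel₀ _ (by positivity), Real.exp_neg, Real.exp_log hpos]
    have h1 : 4 * c₀ * (4 * c₀ / c ^ 2 + 1)⁻¹ < c ^ 2 := by
      rw [← div_eq_mul_inv, div_lt_iff₀ hpos]
      have : c ^ 2 * (4 * c₀ / c ^ 2 + 1) = 4 * c₀ + c ^ 2 := by field_simp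
      nlinarith [sq_pos_of_pos hc]
    have h2 : 0 < 4 * c₀ * (4 * c₀ / c ^ 2 + 1)⁻¹ := by positivity
    nlinarith

theorem setOf_pos_eq_univ {κ c₀ c : ℝ} (hκ : κ ≤ 0) (hc₀ : 0 < c₀) (hc : 0 < c) {F : ℝ → ℝ}
    (hF : F = F₁ κ c₀ c ∨ F = F₂ κ c₀ c) : {t | 0 < F t} = Set.univ := by
  refine Set.eq_univ_of_forall fun t => ?_
  rcases hF with rfl | rfl
  · refine (F₁_pos_iff hc₀ hc _).2 ((mul_nonpos_of_nonneg_of_nonpos ?_ hκ).trans_lt ?_) <;>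
      positivity
  · refine (F₂_pos_iff hc₀ hc _).2 ((mul_nonpos_of_nonneg_of_nonpos ?_ hκ).trans_lt ?_) <;>
      positivity

theorem ordConnected_setOf_pos {κ c₀ c : ℝ} (hc₀ : 0 < c₀) (hc : 0 < c) {F : ℝ → ℝ}
    (hF : F = F₁ κ c₀ c ∨ F = F₂ κ c₀ c) : {t | 0 < F t}.OrdConnected := by
  rcases le_or_gt κ 0 with hκ | hκ
  · rw [setOf_pos_eq_univ hκ hc₀ hc hF]
    exact Set.ordConnected_univ
  -- For `κ > 0` the set is closed upwards for `F₁` and downwards for `F₂`, so one endpoint suffices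
  -- in each case.
  refine ⟨fun a ha b hb t ht => ?_⟩
  rcases hF with rfl | rfl
  · refine (F₁_pos_iff hc₀ hc _).2 (((F₁_pos_iff hc₀ hc _).1 ha).trans_le ?_)
    have := ht.1
    gcongr
  · refine (F₂_pos_iff hc₀ hc _).2 (lt_of_le_of_lt ?_ ((F₂_pos_iff hc₀ hc _).1 hb))
    have := ht.2
    gcongr

/-! ### From charts to the surface -/

variable {S : Type*} [TopologicalSpace S] [ChartedSpace (EuclideanSpace ℝ (Fin 2)) S]
  [IsManifold (𝓡 2) ∞ S]

/-- The chain rule for a map on a surface, read in a chart. -/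
theorem fderiv_comp_chart_symm {G : Type*} [NormedAddCommGroup G] [NormedSpace ℝ G]
    {φ : S → G} (hφ : ContMDiff (𝓡 2) 𝓘(ℝ, G) ∞ φ) (p₀ : S) {y : EuclideanSpace ℝ (Fin 2)}
    (hy : y ∈ (chartAt (EuclideanSpace ℝ (Fin 2)) p₀).target) (v : EuclideanSpace ℝ (Fin 2)) :
    fderiv ℝ (φ ∘ (chartAt (EuclideanSpace ℝ (Fin 2)) p₀).symm) y v =
      mfderiv (𝓡 2) 𝓘(ℝ, G) φ ((chartAt (EuclideanSpace ℝ (Fin 2)) p₀).symm y)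
        (mfderiv (𝓡 2) (𝓡 2) (chartAt (EuclideanSpace ℝ (Fin 2)) p₀).symm y v) := by
  have : IsManifold (𝓡 2) 1 S := IsManifold.of_le (n := ∞) (WithTop.coe_le_coe.2 le_top)
  rw [← mfderiv_eq_fderiv]
  exact mfderiv_comp_apply y (hφ.mdifferentiable (by simp) _)
    ((mdifferentiable_chart (I := 𝓡 2) p₀).mdifferentiableAt_symm hy) v

theorem contDiffOn_comp_chart_symm {G : Type*} [NormedAddCommGroup G] [NormedSpace ℝ G]
    {φ : S → G} (hφ : ContMDiff (𝓡 2) 𝓘(ℝ, G) ∞ φ) (p₀ : S) :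
    ContDiffOn ℝ ∞ (φ ∘ (chartAt (EuclideanSpace ℝ (Fin 2)) p₀).symm)
      (chartAt (EuclideanSpace ℝ (Fin 2)) p₀).target :=
  contMDiffOn_iff_contDiffOn.1 (hφ.comp_contMDiffOn contMDiffOn_chart_symm)

theorem isLocallyConstant_umbilicity {κ c₀ : ℝ} {F G f : ℝ → ℝ} {I : Set ℝ} {φ N : S → Amb}
    {ρ : S → ℝ} (hκ : κ = -1 ∨ κ = 0 ∨ κ = 1) (hc₀ : 0 < c₀)
    (hFs : ContDiff ℝ ∞ F) (hGs : ContDiff ℝ ∞ G) (hF : ∀ t, HasDerivAt F (G t) t)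
    (hG : ∀ t, HasDerivAt G (c₀ * F t) t) (hFG : ∀ t, G t ^ 2 = c₀ * F t ^ 2 + κ)
    (hpos : ∀ t ∈ I, 0 < F t) (hf : f = fun t => Real.log (F t))
    (h : IsTotallyUmbilical κ f I φ N ρ) : IsLocallyConstant ρ := by
  have : IsManifold (𝓡 2) 1 S := IsManifold.of_le (n := ∞) (WithTop.coe_le_coe.2 le_top)
  rw [IsLocallyConstant.iff_eventually_eq]
  intro p₀
  set e := chartAt (EuclideanSpace ℝ (Fin 2)) p₀
  have hρ : ContDiffOn ℝ ∞ (ρ ∘ e.symm) e.target :=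
    contDiffOn_comp_chart_symm h.contMDiff_umbilicity p₀
  have hzero : e.target.EqOn (fderiv ℝ (ρ ∘ e.symm)) 0 := by
    intro y hy
    refine fderiv_umbilicity_eq_zero (φ := φ ∘ e.symm) (N := N ∘ e.symm) (by simp) hκ hc₀ hFs hGs
      hF hG hFG hpos hf e.open_target (contDiffOn_comp_chart_symm h.contMDiff_map p₀)
      (contDiffOn_comp_chart_symm h.contMDiff_normal p₀) hρ (fun y _ => h.mem _) ?_
      (fun y _ => h.tangent _) ?_ ?_ hy
    · intro y hy v w hvw
      rw [fderiv_comp_chart_symm h.contMDiff_map p₀ hy,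
        fderiv_comp_chart_symm h.contMDiff_map p₀ hy] at hvw
      exact (mdifferentiable_chart (I := 𝓡 2) p₀).symm.mfderiv_injective hy (h.immersion _ hvw)
    · intro y hy v
      rw [fderiv_comp_chart_symm h.contMDiff_map p₀ hy]
      exact h.normal _ _
    · intro y hy v z hz
      rw [fderiv_comp_chart_symm h.contMDiff_map p₀ hy,
        fderiv_comp_chart_symm h.contMDiff_normal p₀ hy]
      exact (h.umbilic _ _).2 z hz
  -- The level set is open in the chart domain, which need not be connected.
  have hopen := e.open_target.isOpen_inter_preimage_of_fderiv_eq_zero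
    (hρ.differentiableOn (by simp)) hzero {ρ p₀}
  have hp₀ : p₀ ∈ e.source := mem_chart_source _ p₀
  filter_upwards [(e.isOpen_inter_preimage hopen).mem_nhds
    ⟨hp₀, e.map_source hp₀, by simp [e.left_inv hp₀]⟩] with p hp
  simpa [e.left_inv hp.1] using hp.2.2

end UmbilicalWarped

theorem theorem2 (κ c₀ c : ℝ) (hκ : κ = -1 ∨ κ = 0 ∨ κ = 1) (hc₀ : 0 < c₀) (hc : 0 < c)
    (F f : ℝ → ℝ) (I : Set ℝ)
    (hF : F = UmbilicalWarped.F₁ κ c₀ c ∨ F = UmbilicalWarped.F₂ κ c₀ c)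
    (hI : I = {t | 0 < F t}) (hf : f = fun t => Real.log (F t)) :
    -- `F` is smooth on `ℝ` and positive exactly on the open interval `I`, which is `ℝ` if `κ ≤ 0`
    ContDiff ℝ (⊤ : ℕ∞) F ∧
    I.Nonempty ∧ IsOpen I ∧ I.OrdConnected ∧ (κ ≤ 0 → I = Set.univ) ∧
    -- `f = ln F` is smooth on `I` and solves the equation there
    ContDiffOn ℝ (⊤ : ℕ∞) f I ∧
    (∀ t ∈ I, deriv (deriv f) t + κ * Real.exp (-2 * f t) = 0) ∧
    -- totally umbilical surfaces in the warped product have constant umbilicity function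
    (∀ (S : Type*) [TopologicalSpace S] [ConnectedSpace S]
        [ChartedSpace (EuclideanSpace ℝ (Fin 2)) S]
        [IsManifold (modelWithCornersSelf ℝ (EuclideanSpace ℝ (Fin 2))) (⊤ : ℕ∞) S]
        (φ N : S → UmbilicalWarped.Amb) (ρ : S → ℝ),
        UmbilicalWarped.IsTotallyUmbilical κ f I φ N ρ → ∃ a : ℝ, ∀ p, ρ p = a) := by
  obtain ⟨A, B, hFAB, hAB⟩ := UmbilicalWarped.exists_eq_expSum hc₀ hc hF
  have hne := UmbilicalWarped.nonempty_setOf_pos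
    (by rcases hκ with rfl | rfl | rfl <;> norm_num) hc₀ hc hF
  have hord := UmbilicalWarped.ordConnected_setOf_pos hc₀ hc hF
  have huniv := fun hκ' : κ ≤ 0 => UmbilicalWarped.setOf_pos_eq_univ hκ' hc₀ hc hF
  rw [← hI] at hne hord huniv
  set G := UmbilicalWarped.expSum √c₀ (√c₀ * A) (-(√c₀ * B)) with hGdef
  have hFs : ContDiff ℝ ∞ F := hFAB ▸ UmbilicalWarped.contDiff_expSum _ _ _
  have hGs : ContDiff ℝ ∞ G := UmbilicalWarped.contDiff_expSum _ _ _
  have hFd : ∀ t, HasDerivAt F (G t) t := fun t => by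
    rw [hFAB]; exact UmbilicalWarped.hasDerivAt_expSum _ _ _ t
  have hGd : ∀ t, HasDerivAt G (c₀ * F t) t := fun t => by
    convert UmbilicalWarped.hasDerivAt_expSum √c₀ (√c₀ * A) (-(√c₀ * B)) t using 1
    simp only [hFAB, UmbilicalWarped.expSum]
    linear_combination -(A * Real.exp (√c₀ * t) + B * Real.exp (-(√c₀ * t))) *
      Real.sq_sqrt hc₀.le
  have hFG : ∀ t, G t ^ 2 = c₀ * F t ^ 2 + κ := fun t => by
    rw [hFAB]; exact UmbilicalWarped.expSum_sq hc₀ hAB t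
  have hpos : ∀ t ∈ I, 0 < F t := fun t ht => by rwa [hI] at ht
  have hopen : IsOpen I := hI ▸ isOpen_lt continuous_const hFs.continuous
  refine ⟨hFs, hne, hopen, hord, huniv, ?_, fun t ht => ?_, ?_⟩
  · rw [hf]
    exact hFs.contDiffOn.log fun t ht => (hpos t ht).ne'
  · have hev : deriv f =ᶠ[nhds t] fun s => G s / F s := by
      filter_upwards [hopen.mem_nhds ht] with s hs
      rw [hf]
      exact ((hFd s).log (hpos s hs).ne').deriv
    have hFt := hpos t ht
    have hexp : Real.exp (-2 * f t) = (F t ^ 2)⁻¹ := by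
      rw [hf, neg_mul, Real.exp_neg, two_mul, Real.exp_add, Real.exp_log hFt, sq]
    rw [hev.deriv_eq, ((hGd t).fun_div (hFd t) hFt.ne').deriv, hexp]
    field_simp
    -- Here `f'' = (c₀ F² - F'²) / F²`, and the first integral turns the numerator into `-κ`.
    linear_combination -hFG t
  · intro S _ _ _ _ φ N ρ h
    have hloc := UmbilicalWarped.isLocallyConstant_umbilicity hκ hc₀ hFs hGs hFd hGd hFG hpos hf h
    obtain ⟨p₀⟩ := (inferInstance : Nonempty S)
    exact ⟨ρ p₀, fun p => hloc.apply_eq_of_preconnectedSpace p p₀⟩
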